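/- Let $d>3$. Work in $\hat{\mathbb R}^d=\mathbb R^d\cup\{\infty\}$. A $d$-ball is a closed Euclidean ball of positive radius, the complement in $\hat{\mathbb R}^d$ of an open Euclidean ball of positive radius, or a closed half-space together with $\infty$. Two $d$-balls are tangent if their intersection is a single point (possibly $\infty$). A $d$-ball packing is a collection of $d$-balls with pairwise disjoint interiors; its tangency graph has the balls as vertices and the tangent pairs as edges. A Descartes configuration is a $d$-ball packing consisting of $d+2$ pairwise tangent balls. A collection of $d$-balls is Apollonian if it can be built from a Descartes configuration by finitely many steps, each of which introduces, for some $d+1$ pairwise tangent balls of the current collection, a new $d$-ball (one not yet in the collection) tangent to all of them. A $k$-tree is a finite graph obtained from the complete graph on $k+1$ vertices by repeatedly adding a vertex joined exactly to the members of a $k$-clique; a graph is stacked $k$-polytopal if it is a $k$-tree in which no three distinct $(k+1)$-cliques share $k$ vertices (equivalently, by a theorem of Kleinschmidt, for $k\ge 2$, it is the $1$-skeleton of a stacked $k$-polytope). Theorem 4.9. For $d>3$, if a $d$-ball packing is Apollonian, then its tangency graph is stacked $(d+1)$-polytopal. Moreover, in every such construction of the packing from a Descartes configuration, each newly introduced ball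 is tangent, at the moment of its introduction, to exactly $d+1$ balls of the collection built so far. -/

import Mathlib

open Set

namespace BallPacking

/-- The extended Euclidean space: `ℝ^d` together with one point `∞`
(the one-point compactification). -/
abbrev ExtSpace (d : ℕ) : Type := OnePoint (EuclideanSpace ℝ (Fin d))

/-- The set of finite points of the extended space whose underlying vector lies in `s`. -/
def finitePart {d : ℕ} (s : Set (EuclideanSpace ℝ (Fin d))) : Set (ExtSpace d) :=
  (fun x : EuclideanSpace ℝ (Fin d) => (x : ExtSpace d)) '' s

/-- A `d`-ball: a closed ball (positive curvature `κ`), the exterior of an open ball together with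
`∞` (negative curvature), or a closed half-space together with `∞` (curvature zero). -/
def IsBall {d : ℕ} (S : Set (ExtSpace d)) : Prop :=
  (∃ (c : EuclideanSpace ℝ (Fin d)) (κ : ℝ), 0 < κ ∧
    S = finitePart {x | ‖x - c‖ ≤ 1 / κ}) ∨
  (∃ (c : EuclideanSpace ℝ (Fin d)) (κ : ℝ), κ < 0 ∧
    S = finitePart {x | -1 / κ ≤ ‖x - c‖} ∪ {OnePoint.infty}) ∨
  (∃ (n : EuclideanSpace ℝ (Fin d)) (b : ℝ), ‖n‖ = 1 ∧
    S = finitePart {x | b ≤ inner ℝ x n} ∪ {OnePoint.infty})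

/-- Two balls are tangent if their intersection is a single point (possibly `∞`). -/
def IsTangent {d : ℕ} (A B : Set (ExtSpace d)) : Prop :=
  ∃ t : ExtSpace d, A ∩ B = {t}

/-- A ball packing: a collection of balls with pairwise disjoint interiors. -/
def IsBallPacking {d : ℕ} (P : Set (Set (ExtSpace d))) : Prop :=
  (∀ S ∈ P, IsBall S) ∧ P.Pairwise (fun A B => Disjoint (interior A) (interior B))

/-- The tangency graph of a collection of balls: its vertices are the balls of the collection,
its edges are the tangent pairs. -/
def tangencyGraph {d : ℕ} (P : Set (Set (ExtSpace d))) : SimpleGraph P where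
  Adj A B := A ≠ B ∧ IsTangent (A : Set (ExtSpace d)) (B : Set (ExtSpace d))
  symm := ⟨fun A B ⟨hne, t, ht⟩ => ⟨hne.symm, t, by rw [inter_comm]; exact ht⟩⟩
  loopless := ⟨fun _ h => h.1 rfl⟩

/-- A Descartes configuration: a packing of `d + 2` pairwise tangent `d`-balls. -/
def IsDescartes {d : ℕ} (S : Set (Set (ExtSpace d))) : Prop :=
  IsBallPacking S ∧ S.ncard = d + 2 ∧ S.Pairwise IsTangent

/-- The ball `B` may be introduced into the collection `S`: it is a new ball, and it is tangent to
all members of some `d + 1` pairwise tangent balls of `S`.  (It may touch or intersect further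
balls of `S`.) -/
def CanIntroduce {d : ℕ} (S : Set (Set (ExtSpace d))) (B : Set (ExtSpace d)) : Prop :=
  IsBall B ∧ B ∉ S ∧
    ∃ T : Set (Set (ExtSpace d)), T ⊆ S ∧ T.ncard = d + 1 ∧ T.Pairwise IsTangent ∧
      ∀ A ∈ T, IsTangent A B

/-- `BuiltFrom S₀ S`: the collection `S` is obtained from `S₀` by introducing finitely many balls,
one after the other. -/
inductive BuiltFrom {d : ℕ} (S₀ : Set (Set (ExtSpace d))) : Set (Set (ExtSpace d)) → Prop
  | refl : BuiltFrom S₀ S₀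
  | introduce {S : Set (Set (ExtSpace d))} {B : Set (ExtSpace d)} :
      BuiltFrom S₀ S → CanIntroduce S B → BuiltFrom S₀ (insert B S)

/-- A collection of balls is Apollonian if it can be built from a Descartes configuration. -/
def IsApollonian {d : ℕ} (S : Set (Set (ExtSpace d))) : Prop :=
  ∃ S₀ : Set (Set (ExtSpace d)), IsDescartes S₀ ∧ BuiltFrom S₀ S

/-- The subgraph of `G` induced on the vertex set `s` is a `k`-tree: it arises from a complete graph
on `k + 1` vertices by repeatedly adding a vertex whose neighbours among the earlier vertices are
exactly the members of a `k`-clique. -/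
inductive IsKTreeOn {V : Type*} (G : SimpleGraph V) (k : ℕ) : Set V → Prop
  | base (s : Finset V) : G.IsNClique (k + 1) s → IsKTreeOn G k (s : Set V)
  | add (s : Set V) (v : V) (t : Finset V) :
      IsKTreeOn G k s → v ∉ s → (t : Set V) ⊆ s → G.IsNClique k t →
      (∀ u ∈ s, G.Adj v u ↔ u ∈ t) → IsKTreeOn G k (insert v s)

/-- `G` is a `k`-tree. -/
def IsKTree {V : Type*} (G : SimpleGraph V) (k : ℕ) : Prop :=
  IsKTreeOn G k univ

/-- `G` is a stacked `k`-polytopal graph: a `k`-tree in which no three `(k + 1)`-cliques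
share `k` vertices. -/
def IsStackedPolytopal {V : Type*} (G : SimpleGraph V) (k : ℕ) : Prop :=
  IsKTree G k ∧
    ¬ ∃ t a b c : Finset V, t.card = k ∧ t ⊆ a ∧ t ⊆ b ∧ t ⊆ c ∧
      G.IsNClique (k + 1) a ∧ G.IsNClique (k + 1) b ∧ G.IsNClique (k + 1) c ∧
      a ≠ b ∧ a ≠ c ∧ b ≠ c

end BallPacking

/-!
Each ball is a unit vector of the Lorentz space `ℝ^(d+1,1)` (curvature-center coordinates), and
tangent balls have Lorentz product `-1` (`lorentz_eq_neg_one_of_inter`). A cluster, that is, a set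
of `d + 2` pairwise tangent balls, is then a basis with Gram matrix `2 I - J`, and the
Descartes-Soddy relation follows: a ball `B ≠ Z` tangent to the members of `T`, where `insert Z T`
is a cluster, has the vector `-Z + 2 / (d - 1) * ∑ A ∈ T, A` (`IsCluster.vec_eq`). In particular at
most two balls touch all of `T`, so that three clusters never share `d + 1` balls.

In terms of the renormalized product `sep A B = (1 + ⟪A, B⟫) / 2`, which is `1` for equal and `0` for
tangent balls, the relation reads
`sep X B = -sep X Z + 2 / (d - 1) * (∑ A ∈ T, sep X A - 1)` (`IsCluster.sep_eq`). All separations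
are thus rational. The condition `d > 3` means that `2 / (d - 1)` is not an integer, so that it has
`p`-adic norm `> 1` for some prime `p`. Walk from cluster to cluster by exchanging one ball at a
time, without ever undoing the exchange just made, and let `X` be the ball dropped first. The ball
introduced last has a separation from `X` of `p`-adic norm `> 1`, strictly larger than for the other
members of its cluster; since that ball is not the next one to be dropped, the ultrametric
inequality multiplies the norm by `|2 / (d - 1)|` in the next step (`padicNorm_reflection_eq`).
Hence this separation never returns to `0`: a new ball touches only the balls that define it.

The walks do not appear in the formal proof. They are replaced by an invariant of the collection,
`IsTreelike`, which says where the dominant separations are, between a ball and a cluster and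
between two clusters, and that the balls attaining them can be exchanged within the collection.
The second kind is what makes the induction work: it describes how the ball just introduced is
separated from the older clusters. `IsAttached.isTreelike_insert` shows that the invariant persists,
and `IsAttached.isTangent_iff` that the new ball has exactly `d + 1` neighbours, which form a
clique; so the tangency graph is a `(d + 1)`-tree.
-/

namespace BallPacking

/-! ### Balls as unit vectors of Lorentz space -/

/-- The space `ℝ^(d+1,1)` of curvature-center coordinates `(m, κ, κ')`: for a ball with center `c`
and curvature `κ ≠ 0`, `m = κ c` and `κ' = κ ‖c‖² - 1 / κ`; for the half-space `b ≤ ⟪x, n⟫`, `m = n`,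
`κ = 0` and `κ' = 2 b`. -/
abbrev BallVec (d : ℕ) : Type := EuclideanSpace ℝ (Fin d) × ℝ × ℝ

/-- The Lorentz form on curvature-center coordinates, normalized so that balls have norm `1` and
tangent balls have product `-1`. -/
noncomputable def lorentz (d : ℕ) : BallVec d →ₗ[ℝ] BallVec d →ₗ[ℝ] ℝ :=
  LinearMap.mk₂ ℝ (fun v w => inner ℝ v.1 w.1 - (v.2.1 * w.2.2 + v.2.2 * w.2.1) / 2)
    (fun v v' w => by simp [inner_add_left]; ring)
    (fun r v w => by simp [inner_smul_left]; ring)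
    (fun v w w' => by simp [inner_add_right]; ring)
    (fun r v w => by simp [inner_smul_right]; ring)

lemma lorentz_apply {d : ℕ} (v w : BallVec d) :
    lorentz d v w = inner ℝ v.1 w.1 - (v.2.1 * w.2.2 + v.2.2 * w.2.1) / 2 := rfl

lemma lorentz_comm {d : ℕ} (v w : BallVec d) : lorentz d v w = lorentz d w v := by
  rw [lorentz_apply, lorentz_apply, real_inner_comm]; ring

/-- The quadratic function that is nonpositive exactly on the finite part of the ball with
coordinate vector `v`. -/
noncomputable def ballFun {d : ℕ} (v : BallVec d) (x : EuclideanSpace ℝ (Fin d)) : ℝ :=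
  v.2.1 * ‖x‖ ^ 2 - 2 * inner ℝ v.1 x + v.2.2

/-- The subset of the extended space with coordinate vector `v`; it contains `∞` exactly when
the curvature is nonpositive. -/
def ballOf {d : ℕ} (v : BallVec d) : Set (ExtSpace d) :=
  finitePart {x | ballFun v x ≤ 0} ∪ {t | t = OnePoint.infty ∧ v.2.1 ≤ 0}

lemma coe_mem_ballOf {d : ℕ} (v : BallVec d) (x : EuclideanSpace ℝ (Fin d)) :
    (x : ExtSpace d) ∈ ballOf v ↔ ballFun v x ≤ 0 := by
  simp [ballOf, finitePart]

lemma infty_mem_ballOf {d : ℕ} (v : BallVec d) :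
    (OnePoint.infty : ExtSpace d) ∈ ballOf v ↔ v.2.1 ≤ 0 := by
  simp [ballOf, finitePart]

lemma ballFun_eq_of_center {d : ℕ} (c x : EuclideanSpace ℝ (Fin d)) (κ : ℝ) :
    ballFun (κ • c, κ, κ * ‖c‖ ^ 2 - 1 / κ) x = κ * ‖x - c‖ ^ 2 - 1 / κ := by
  simp only [ballFun, norm_sub_sq_real, inner_smul_left, real_inner_comm c x]
  simp
  ring

lemma lorentz_self_of_center {d : ℕ} (c : EuclideanSpace ℝ (Fin d)) {κ : ℝ} (hκ : κ ≠ 0) :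
    lorentz d (κ • c, κ, κ * ‖c‖ ^ 2 - 1 / κ) (κ • c, κ, κ * ‖c‖ ^ 2 - 1 / κ) = 1 := by
  rw [lorentz_apply, inner_smul_left, inner_smul_right, real_inner_self_eq_norm_sq]
  simp
  field_simp
  ring

lemma IsBall.exists_eq_ballOf {d : ℕ} {S : Set (ExtSpace d)} (hS : IsBall S) :
    ∃ v : BallVec d, lorentz d v v = 1 ∧ S = ballOf v := by
  rcases hS with ⟨c, κ, hκ, rfl⟩ | ⟨c, κ, hκ, rfl⟩ | ⟨n, b, hn, rfl⟩
  · refine ⟨_, lorentz_self_of_center c hκ.ne', ?_⟩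
    ext t
    induction t using OnePoint.rec with
    | infty => simp [infty_mem_ballOf, finitePart, hκ]
    | coe x =>
      rw [coe_mem_ballOf, ballFun_eq_of_center]
      have : κ * ‖x - c‖ ^ 2 - 1 / κ ≤ 0 ↔ ‖x - c‖ ≤ 1 / κ := by
        rw [← pow_le_pow_iff_left₀ (norm_nonneg _) (one_div_pos.2 hκ).le two_ne_zero, sub_nonpos,
          ← le_div_iff₀' hκ]
        rw [show (1 / κ) ^ 2 = 1 / κ / κ by field_simp]
      rw [this]
      simp [finitePart]
  · refine ⟨_, lorentz_self_of_center c hκ.ne, ?_⟩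
    ext t
    induction t using OnePoint.rec with
    | infty => simp [infty_mem_ballOf, hκ.le]
    | coe x =>
      rw [coe_mem_ballOf, ballFun_eq_of_center]
      have h0 : 0 < -1 / κ := div_pos_of_neg_of_neg (by norm_num) hκ
      have : κ * ‖x - c‖ ^ 2 - 1 / κ ≤ 0 ↔ -1 / κ ≤ ‖x - c‖ := by
        rw [← pow_le_pow_iff_left₀ h0.le (norm_nonneg _) two_ne_zero, sub_nonpos,
          ← div_le_iff_of_neg' hκ]
        rw [show (-1 / κ) ^ 2 = 1 / κ / κ by field_simp]
      rw [this]
      simp [finitePart]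
  · refine ⟨(n, 0, 2 * b), by simp [lorentz_apply, hn], ?_⟩
    ext t
    induction t using OnePoint.rec with
    | infty => simp [infty_mem_ballOf]
    | coe x =>
      rw [coe_mem_ballOf]
      simp [finitePart, ballFun, real_inner_comm n x]

/-! ### Tangency and the Lorentz form -/

/-- Half the gradient of `ballFun v` at `x`. -/
noncomputable def ballGrad {d : ℕ} (v : BallVec d) (x : EuclideanSpace ℝ (Fin d)) :
    EuclideanSpace ℝ (Fin d) := v.2.1 • x - v.1

lemma ballFun_add_smul {d : ℕ} (v : BallVec d) (x h : EuclideanSpace ℝ (Fin d)) (t : ℝ) :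
    ballFun v (x + t • h) =
      ballFun v x + t * (2 * inner ℝ (ballGrad v x) h + t * (v.2.1 * ‖h‖ ^ 2)) := by
  simp only [ballFun, ballGrad, norm_add_sq_real, inner_add_right, inner_smul_right,
    inner_sub_left, inner_smul_left, norm_smul, mul_pow]
  simp
  ring

lemma inner_ballGrad {d : ℕ} (v w : BallVec d) (x : EuclideanSpace ℝ (Fin d)) :
    inner ℝ (ballGrad v x) (ballGrad w x) =
      lorentz d v w + (v.2.1 * ballFun w x + w.2.1 * ballFun v x) / 2 := by
  simp only [ballFun, ballGrad, lorentz_apply, inner_sub_left, inner_sub_right, inner_smul_left,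
    inner_smul_right, real_inner_self_eq_norm_sq, real_inner_comm w.1 x]
  simp
  ring

/-- Points near a point of a ball, in a direction pointing inwards, still belong to the ball. -/
lemma eventually_ballFun_nonpos {d : ℕ} {v : BallVec d} {x h : EuclideanSpace ℝ (Fin d)}
    (hx : ballFun v x < 0 ∨ ballFun v x ≤ 0 ∧ inner ℝ (ballGrad v x) h < 0) :
    ∀ᶠ t in nhdsWithin (0 : ℝ) (Ioi 0), ballFun v (x + t • h) ≤ 0 := by
  rcases hx with hx | ⟨hx, hg⟩
  · have hc : Continuous fun t : ℝ => ballFun v (x + t • h) := by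
      unfold ballFun; fun_prop
    have := hc.tendsto 0
    simp only [zero_smul, add_zero] at this
    filter_upwards [nhdsWithin_le_nhds (this.eventually (gt_mem_nhds hx))] with t ht using ht.le
  · have hc : Continuous fun t : ℝ =>
        2 * inner ℝ (ballGrad v x) h + t * (v.2.1 * ‖h‖ ^ 2) := by fun_prop
    have := hc.tendsto 0
    simp only [zero_mul, add_zero] at this
    filter_upwards [nhdsWithin_le_nhds (this.eventually (gt_mem_nhds (by linarith : _ < (0 : ℝ)))),
      self_mem_nhdsWithin] with t ht h0
    rw [ballFun_add_smul]
    have : t * (2 * inner ℝ (ballGrad v x) h + t * (v.2.1 * ‖h‖ ^ 2)) < 0 :=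
      mul_neg_of_pos_of_neg h0 ht
    linarith

/-- Points far away, in a suitable direction, belong to a ball containing `∞`. -/
lemma eventually_ballFun_smul_nonpos {d : ℕ} {v : BallVec d} {h : EuclideanSpace ℝ (Fin d)}
    (hv : v.2.1 < 0 ∧ h ≠ 0 ∨ v.2.1 = 0 ∧ 0 < inner ℝ v.1 h) :
    ∀ᶠ t : ℝ in Filter.atTop, ballFun v (t • h) ≤ 0 := by
  have key : ∀ t : ℝ, ballFun v (t • h) =
      v.2.2 + t * (-2 * inner ℝ v.1 h + t * (v.2.1 * ‖h‖ ^ 2)) := by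
    intro t
    have := ballFun_add_smul v 0 h t
    simp only [zero_add] at this
    rw [this]
    simp [ballFun, ballGrad]
  have : Filter.Tendsto (fun t : ℝ => v.2.2 + t * (-2 * inner ℝ v.1 h + t * (v.2.1 * ‖h‖ ^ 2)))
      Filter.atTop Filter.atBot := by
    refine Filter.tendsto_atBot_add_const_left _ _ ?_
    rcases hv with ⟨h1, h2⟩ | ⟨h1, h2⟩
    · refine Filter.tendsto_id.atTop_mul_atBot₀ (Filter.tendsto_atBot_add_const_left _ _ ?_)
      refine Filter.tendsto_id.atTop_mul_const_of_neg ?_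
      exact mul_neg_of_neg_of_pos h1 (by positivity)
    · simp only [h1, zero_mul, mul_zero, add_zero]
      exact Filter.tendsto_id.atTop_mul_const_of_neg (by linarith)
  filter_upwards [this.eventually_le_atBot 0] with t ht
  rw [key]; exact ht

lemma add_ne_zero_and_inner_pos {F : Type*} [NormedAddCommGroup F] [InnerProductSpace ℝ F]
    {a b : F} (ha : inner ℝ a a = (1 : ℝ)) (hb : inner ℝ b b = (1 : ℝ))
    (hab : inner ℝ a b ≠ (-1 : ℝ)) :
    a + b ≠ 0 ∧ 0 < inner ℝ a (a + b) ∧ 0 < inner ℝ b (a + b) := by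
  have h1 : inner ℝ (a + b) (a + b) = 2 * (1 + inner ℝ a b : ℝ) := by
    simp only [inner_add_left, inner_add_right, ha, hb, real_inner_comm a b]; ring
  have h0 : a + b ≠ 0 := by
    intro h
    rw [h, inner_zero_left] at h1
    exact hab (by linarith)
  have h2 : (0 : ℝ) < inner ℝ (a + b) (a + b) := real_inner_self_pos.2 h0
  refine ⟨h0, ?_, ?_⟩
  · rw [inner_add_right, ha]; linarith
  · rw [inner_add_right, hb, real_inner_comm]; linarith

/-- Balls meeting in a single point have Lorentz product `-1`: otherwise a short step from a finite
common point, or a long step towards a common point `∞`, along the sum of the inner normals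
reaches a second common point. -/
lemma lorentz_eq_neg_one_of_inter {d : ℕ} (hd : d ≠ 0) {v w : BallVec d}
    (hv : lorentz d v v = 1) (hw : lorentz d w w = 1) {t : ExtSpace d}
    (ht : ballOf v ∩ ballOf w = {t}) : lorentz d v w = -1 := by
  have : Nonempty (Fin d) := ⟨⟨0, Nat.pos_of_ne_zero hd⟩⟩
  obtain ⟨y, hy⟩ := exists_ne (0 : EuclideanSpace ℝ (Fin d))
  have htm : t ∈ ballOf v ∩ ballOf w := ht ▸ mem_singleton t
  by_contra hne
  induction t using OnePoint.rec with
  | infty =>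
    have hv0 := (infty_mem_ballOf v).1 htm.1
    have hw0 := (infty_mem_ballOf w).1 htm.2
    have key : ∀ h : EuclideanSpace ℝ (Fin d),
        (v.2.1 < 0 ∧ h ≠ 0 ∨ v.2.1 = 0 ∧ 0 < inner ℝ v.1 h) →
        (w.2.1 < 0 ∧ h ≠ 0 ∨ w.2.1 = 0 ∧ 0 < inner ℝ w.1 h) → False := by
      intro h h1 h2
      obtain ⟨s, hs1, hs2⟩ :=
        ((eventually_ballFun_smul_nonpos h1).and (eventually_ballFun_smul_nonpos h2)).exists
      have : ((s • h : EuclideanSpace ℝ (Fin d)) : ExtSpace d) ∈ ballOf v ∩ ballOf w :=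
        ⟨(coe_mem_ballOf _ _).2 hs1, (coe_mem_ballOf _ _).2 hs2⟩
      rw [ht] at this
      exact OnePoint.coe_ne_infty _ this
    have unit : ∀ u : BallVec d, lorentz d u u = 1 → u.2.1 = 0 → inner ℝ u.1 u.1 = (1 : ℝ) := by
      intro u hu h0
      rw [lorentz_apply, h0] at hu
      simpa using hu
    have nz : ∀ u : EuclideanSpace ℝ (Fin d), inner ℝ u u = (1 : ℝ) → u ≠ 0 := by
      rintro u hu rfl
      simp at hu
    rcases hv0.lt_or_eq with hv0 | hv0 <;> rcases hw0.lt_or_eq with hw0 | hw0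
    · exact key y (.inl ⟨hv0, hy⟩) (.inl ⟨hw0, hy⟩)
    · have := unit w hw hw0
      exact key w.1 (.inl ⟨hv0, nz _ this⟩) (.inr ⟨hw0, by rw [this]; norm_num⟩)
    · have := unit v hv hv0
      exact key v.1 (.inr ⟨hv0, by rw [this]; norm_num⟩) (.inl ⟨hw0, nz _ this⟩)
    · obtain ⟨-, h1, h2⟩ := add_ne_zero_and_inner_pos (unit v hv hv0) (unit w hw hw0)
        (by rw [lorentz_apply, hv0, hw0] at hne; simpa using hne)
      exact key _ (.inr ⟨hv0, h1⟩) (.inr ⟨hw0, h2⟩)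
  | coe x =>
    have hvx := (coe_mem_ballOf v x).1 htm.1
    have hwx := (coe_mem_ballOf w x).1 htm.2
    have key : ∀ h : EuclideanSpace ℝ (Fin d), h ≠ 0 →
        (ballFun v x < 0 ∨ ballFun v x ≤ 0 ∧ inner ℝ (ballGrad v x) h < 0) →
        (ballFun w x < 0 ∨ ballFun w x ≤ 0 ∧ inner ℝ (ballGrad w x) h < 0) → False := by
      intro h h0 h1 h2
      obtain ⟨s, ⟨hs1, hs2⟩, hs⟩ := (((eventually_ballFun_nonpos h1).and
        (eventually_ballFun_nonpos h2)).and self_mem_nhdsWithin).exists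
      have hm : ((x + s • h : EuclideanSpace ℝ (Fin d)) : ExtSpace d) ∈ ballOf v ∩ ballOf w :=
        ⟨(coe_mem_ballOf _ _).2 hs1, (coe_mem_ballOf _ _).2 hs2⟩
      rw [ht, mem_singleton_iff, OnePoint.coe_eq_coe, add_eq_left, smul_eq_zero] at hm
      rcases hm with hm | hm
      · exact (ne_of_gt hs) hm
      · exact h0 hm
    have unit : ∀ u : BallVec d, lorentz d u u = 1 → ballFun u x = 0 →
        inner ℝ (ballGrad u x) (ballGrad u x) = (1 : ℝ) := by
      intro u hu h0
      rw [inner_ballGrad, h0, hu]; simp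
    have nz : ∀ u : EuclideanSpace ℝ (Fin d), inner ℝ u u = (1 : ℝ) → -u ≠ 0 := by
      rintro u hu h
      rw [neg_eq_zero.1 h] at hu
      simp at hu
    rcases hvx.lt_or_eq with hv0 | hv0 <;> rcases hwx.lt_or_eq with hw0 | hw0
    · exact key y hy (.inl hv0) (.inl hw0)
    · have := unit w hw hw0
      exact key _ (nz _ this) (.inl hv0) (.inr ⟨hwx, by rw [inner_neg_right, this]; norm_num⟩)
    · have := unit v hv hv0
      exact key _ (nz _ this) (.inr ⟨hvx, by rw [inner_neg_right, this]; norm_num⟩) (.inl hw0)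
    · obtain ⟨h0, h1, h2⟩ := add_ne_zero_and_inner_pos (unit v hv hv0) (unit w hw hw0)
        (by rw [inner_ballGrad, hv0, hw0]; simpa using hne)
      exact key _ (neg_ne_zero.2 h0) (.inr ⟨hvx, by rw [inner_neg_right]; linarith⟩)
        (.inr ⟨hwx, by rw [inner_neg_right]; linarith⟩)

/-! ### The separation of two balls -/

open Classical in
/-- A unit coordinate vector of a ball (and `0` for a set that is not a ball). -/
noncomputable def vec {d : ℕ} (A : Set (ExtSpace d)) : BallVec d :=
  if h : IsBall A then h.exists_eq_ballOf.choose else 0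

lemma IsBall.lorentz_vec_self {d : ℕ} {A : Set (ExtSpace d)} (hA : IsBall A) :
    lorentz d (vec A) (vec A) = 1 := by
  rw [vec, dif_pos hA]; exact hA.exists_eq_ballOf.choose_spec.1

lemma IsBall.eq_ballOf_vec {d : ℕ} {A : Set (ExtSpace d)} (hA : IsBall A) :
    A = ballOf (vec A) := by
  rw [vec, dif_pos hA]; exact hA.exists_eq_ballOf.choose_spec.2

lemma IsBall.eq_of_vec_eq {d : ℕ} {A B : Set (ExtSpace d)} (hA : IsBall A) (hB : IsBall B)
    (h : vec A = vec B) : A = B := by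
  rw [hA.eq_ballOf_vec, hB.eq_ballOf_vec, h]

lemma IsTangent.symm {d : ℕ} {A B : Set (ExtSpace d)} (h : IsTangent A B) : IsTangent B A := by
  obtain ⟨t, ht⟩ := h
  exact ⟨t, by rw [inter_comm]; exact ht⟩

lemma IsTangent.lorentz_vec {d : ℕ} (hd : d ≠ 0) {A B : Set (ExtSpace d)} (h : IsTangent A B)
    (hA : IsBall A) (hB : IsBall B) : lorentz d (vec A) (vec B) = -1 := by
  obtain ⟨t, ht⟩ := h
  refine lorentz_eq_neg_one_of_inter hd hA.lorentz_vec_self hB.lorentz_vec_self (t := t) ?_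
  rw [← hA.eq_ballOf_vec, ← hB.eq_ballOf_vec, ht]

/-- The affine renormalization `(1 + ⟪A, B⟫) / 2` of the Lorentz product of two balls: it is `1` for
equal balls and `0` for tangent balls. -/
noncomputable def sep {d : ℕ} (A B : Set (ExtSpace d)) : ℝ := (1 + lorentz d (vec A) (vec B)) / 2

lemma sep_comm {d : ℕ} (A B : Set (ExtSpace d)) : sep A B = sep B A := by
  rw [sep, sep, lorentz_comm]

lemma IsBall.sep_self {d : ℕ} {A : Set (ExtSpace d)} (hA : IsBall A) : sep A A = 1 := by
  rw [sep, hA.lorentz_vec_self]; norm_num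

lemma IsTangent.sep_eq_zero {d : ℕ} (hd : d ≠ 0) {A B : Set (ExtSpace d)} (h : IsTangent A B)
    (hA : IsBall A) (hB : IsBall B) : sep A B = 0 := by
  rw [sep, h.lorentz_vec hd hA hB]; norm_num

/-! ### The two balls tangent to `d + 1` pairwise tangent balls -/

lemma lorentz_sum_of_gram {d : ℕ} {ι : Type*} [Fintype ι] [DecidableEq ι] {f : ι → BallVec d}
    (hf : ∀ i j, lorentz d (f i) (f j) = if i = j then 1 else -1) (g : ι → ℝ) (j : ι) :
    lorentz d (∑ i, g i • f i) (f j) = 2 * g j - ∑ i, g i := by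
  have : ∀ i, g i * (if i = j then (1 : ℝ) else -1) = (if i = j then 2 * g i else 0) - g i := by
    intro i
    split_ifs <;> ring
  simp [hf, this, Finset.sum_sub_distrib]

lemma linearIndependent_of_gram {d : ℕ} (hd : d ≠ 0) {ι : Type*} [Fintype ι] [DecidableEq ι]
    (hι : Fintype.card ι = d + 2) {f : ι → BallVec d}
    (hf : ∀ i j, lorentz d (f i) (f j) = if i = j then 1 else -1) : LinearIndependent ℝ f := by
  rw [Fintype.linearIndependent_iff]
  intro g hg
  have h1 : ∀ j, g j = (∑ i, g i) / 2 := by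
    intro j
    have := lorentz_sum_of_gram hf g j
    rw [hg] at this
    simp at this
    linarith
  have h2 : ∑ i, g i = (d + 2) * ((∑ i, g i) / 2) := by
    conv_lhs => rw [Finset.sum_congr rfl fun j _ => h1 j]
    simp [hι]
  have h3 : (d : ℝ) * ∑ i, g i = 0 := by linarith
  have h4 : ∑ i, g i = 0 := by
    rcases mul_eq_zero.1 h3 with h | h
    · exact absurd (by exact_mod_cast h) hd
    · exact h
  intro i
  rw [h1 i, h4, zero_div]

/-- The generalized Descartes-Soddy relation: `d + 2` pairwise tangent balls form a basis of
Lorentz space, and a unit vector having product `-1` with all but one of them is either the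
remaining one or its mirror image. -/
lemma eq_or_eq_reflection_of_gram {d : ℕ} (hd : 1 < d) {ι : Type*} [Fintype ι] [DecidableEq ι]
    (hι : Fintype.card ι = d + 2) {f : ι → BallVec d}
    (hf : ∀ i j, lorentz d (f i) (f j) = if i = j then 1 else -1) (z : ι) {b : BallVec d}
    (hb : lorentz d b b = 1) (hbf : ∀ i, i ≠ z → lorentz d b (f i) = -1) :
    b = f z ∨ b = -f z + (2 / ((d : ℝ) - 1)) • ∑ i ∈ Finset.univ.erase z, f i := by
  have hli := linearIndependent_of_gram (by omega) hι hf
  have hspan : Submodule.span ℝ (range f) = ⊤ := by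
    refine hli.span_eq_top_of_card_eq_finrank' ?_
    rw [hι]
    simp [Module.finrank_prod]
  have hbs : b ∈ Submodule.span ℝ (range f) := hspan ▸ Submodule.mem_top
  obtain ⟨g, rfl⟩ := (Submodule.mem_span_range_iff_exists_fun ℝ).1 hbs
  have hd1 : (0 : ℝ) < (d : ℝ) - 1 := by
    have : (1 : ℝ) < d := by exact_mod_cast hd
    linarith
  set β := ((∑ i, g i) - 1) / 2 with hβ
  have hgi : ∀ i, i ≠ z → g i = β := by
    intro i hi
    have := hbf i hi
    rw [lorentz_sum_of_gram hf] at this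
    rw [hβ]; linarith
  have hcard : (Finset.univ.erase z).card = d + 1 := by
    rw [Finset.card_erase_of_mem (Finset.mem_univ _), Finset.card_univ, hι]; rfl
  have hsplit : ∑ i, g i = g z + (d + 1) * β := by
    rw [← Finset.add_sum_erase _ _ (Finset.mem_univ z),
      Finset.sum_congr rfl fun i hi => hgi i (Finset.ne_of_mem_erase hi)]
    simp [hcard]
  have hgz : g z = 1 - (d - 1) * β := by
    have : ∑ i, g i = 2 * β + 1 := by rw [hβ]; ring
    linarith
  have hnorm : lorentz d (∑ i, g i • f i) (∑ i, g i • f i) =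
      ∑ j, g j * (2 * g j - ∑ i, g i) := by
    conv_lhs => rw [map_sum]
    refine Finset.sum_congr rfl fun j _ => ?_
    rw [map_smul, lorentz_sum_of_gram hf, smul_eq_mul]
  have hrest : ∑ j ∈ Finset.univ.erase z, g j * (2 * g j - ∑ i, g i) =
      ∑ j ∈ Finset.univ.erase z, β * (2 * β - ∑ i, g i) :=
    Finset.sum_congr rfl fun j hj => by rw [hgi j (Finset.ne_of_mem_erase hj)]
  rw [hb, ← Finset.add_sum_erase _ _ (Finset.mem_univ z), hrest, hsplit, hgz] at hnorm
  simp only [Finset.sum_const, hcard, nsmul_eq_mul] at hnorm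
  push_cast at hnorm
  -- Comparing norms, the common coefficient `β` of the balls other than `f z` solves a quadratic
  -- equation; the root `0` gives `f z` and the root `2 / (d - 1)` its mirror image.
  have hquad : β * (((d : ℝ) - 1) * β - 2) = 0 := by
    have hd0 : (d : ℝ) ≠ 0 := by linarith
    apply mul_left_cancel₀ hd0
    linarith
  have hb' : ∑ i, g i • f i = g z • f z + β • ∑ i ∈ Finset.univ.erase z, f i := by
    rw [← Finset.add_sum_erase _ _ (Finset.mem_univ z), Finset.smul_sum]
    congr 1
    exact Finset.sum_congr rfl fun i hi => by rw [hgi i (Finset.ne_of_mem_erase hi)]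
  rw [hb', hgz]
  rcases mul_eq_zero.1 hquad with h | h
  · left; simp [h]
  · right
    have hc : β = 2 / ((d : ℝ) - 1) := by field_simp; linarith
    rw [show 1 - ((d : ℝ) - 1) * β = -1 by linarith, hc, neg_one_smul]

/-- A set of balls is a cluster if it consists of `d + 2` pairwise tangent balls. -/
structure IsCluster {d : ℕ} (C : Finset (Set (ExtSpace d))) : Prop where
  isBall : ∀ A ∈ C, IsBall A
  card : C.card = d + 2
  pairwise : (C : Set (Set (ExtSpace d))).Pairwise IsTangent

open Classical in
lemma IsCluster.vec_eq {d : ℕ} (hd : 1 < d) {T : Finset (Set (ExtSpace d))} {Z B : Set (ExtSpace d)}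
    (hZT : Z ∉ T) (hC : IsCluster (insert Z T)) (hB : IsBall B) (hBT : ∀ A ∈ T, IsTangent A B)
    (hBZ : B ≠ Z) : vec B = -vec Z + (2 / ((d : ℝ) - 1)) • ∑ A ∈ T, vec A := by
  have hd0 : d ≠ 0 := by omega
  set C := insert Z T with hCdef
  have hgram : ∀ i j : C, lorentz d (vec (i : Set (ExtSpace d))) (vec (j : Set (ExtSpace d))) =
      if i = j then 1 else -1 := by
    intro i j
    split_ifs with h
    · subst h; exact (hC.isBall _ i.2).lorentz_vec_self
    · exact (hC.pairwise i.2 j.2 fun h' => h (Subtype.ext h')).lorentz_vec hd0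
        (hC.isBall _ i.2) (hC.isBall _ j.2)
  have hZ : Z ∈ C := Finset.mem_insert_self _ _
  have hsum : ∑ i ∈ (Finset.univ : Finset C).erase ⟨Z, hZ⟩, vec (i : Set (ExtSpace d)) =
      ∑ A ∈ T, vec A := by
    have h1 := Finset.add_sum_erase (Finset.univ : Finset C)
      (fun i => vec (i : Set (ExtSpace d))) (Finset.mem_univ (⟨Z, hZ⟩ : C))
    have h2 : ∑ i : C, vec (i : Set (ExtSpace d)) = ∑ A ∈ C, vec A :=
      Finset.sum_coe_sort C (fun A => vec A)
    have h3 : ∑ A ∈ C, vec A = vec Z + ∑ A ∈ T, vec A := Finset.sum_insert hZT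
    rw [h2, h3] at h1
    exact add_left_cancel h1
  have hBf : ∀ i : C, i ≠ ⟨Z, hZ⟩ → lorentz d (vec B) (vec (i : Set (ExtSpace d))) = -1 := by
    intro i hi
    have hiT : (i : Set (ExtSpace d)) ∈ T :=
      (Finset.mem_insert.1 i.2).resolve_left fun h => hi (Subtype.ext h)
    exact (hBT _ hiT).symm.lorentz_vec hd0 hB (hC.isBall _ i.2)
  rcases eq_or_eq_reflection_of_gram hd (by rw [Fintype.card_coe]; exact hC.card) hgram ⟨Z, hZ⟩
    hB.lorentz_vec_self hBf with h | h
  · exact absurd (hB.eq_of_vec_eq (hC.isBall _ hZ) h) hBZ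
  · rw [h, hsum]

open Classical in
/-- The mirror image of a ball in the cluster `insert Z T` is unique. -/
lemma IsCluster.eq_of_tangent {d : ℕ} (hd : 1 < d) {T : Finset (Set (ExtSpace d))}
    {Z B B' : Set (ExtSpace d)} (hZT : Z ∉ T) (hC : IsCluster (insert Z T))
    (hB : IsBall B) (hBT : ∀ A ∈ T, IsTangent A B) (hBZ : B ≠ Z)
    (hB' : IsBall B') (hBT' : ∀ A ∈ T, IsTangent A B') (hBZ' : B' ≠ Z) : B = B' :=
  hB.eq_of_vec_eq hB' (by rw [hC.vec_eq hd hZT hB hBT hBZ, hC.vec_eq hd hZT hB' hBT' hBZ'])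

open Classical in
lemma IsCluster.sep_eq {d : ℕ} (hd : 1 < d) {T : Finset (Set (ExtSpace d))} {Z B : Set (ExtSpace d)}
    (hZT : Z ∉ T) (hC : IsCluster (insert Z T)) (hB : IsBall B) (hBT : ∀ A ∈ T, IsTangent A B)
    (hBZ : B ≠ Z) (X : Set (ExtSpace d)) :
    sep X B = -sep X Z + (2 / ((d : ℝ) - 1)) * (∑ A ∈ T, sep X A - 1) := by
  have hd1 : (d : ℝ) - 1 ≠ 0 := by
    have : (1 : ℝ) < d := by exact_mod_cast hd
    linarith
  have hcard : (T.card : ℝ) = d + 1 := by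
    have := hC.card
    rw [Finset.card_insert_of_notMem hZT] at this
    have h : T.card = d + 1 := by omega
    exact_mod_cast h
  simp only [sep]
  rw [hC.vec_eq hd hZT hB hBT hBZ, ← Finset.sum_div, Finset.sum_add_distrib]
  simp only [map_add, map_neg, map_smul, map_sum, Finset.sum_const, hcard, nsmul_eq_mul,
    smul_eq_mul, mul_one]
  field_simp
  ring

/-! ### Growth of a nonarchimedean norm under reflections -/

lemma exists_prime_one_lt_padicNorm {q : ℚ} (hq : q.den ≠ 1) :
    ∃ p : ℕ, p.Prime ∧ 1 < padicNorm p q := by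
  obtain ⟨p, hp, hpd⟩ := Nat.exists_prime_and_dvd hq
  have : Fact p.Prime := ⟨hp⟩
  refine ⟨p, hp, ?_⟩
  have hnum : padicNorm p (q.num : ℚ) = 1 := by
    rw [padicNorm.int_eq_one_iff]
    intro h
    have := Nat.dvd_gcd (Int.natCast_dvd.1 h) hpd
    rw [q.reduced] at this
    exact hp.one_lt.ne' (Nat.dvd_one.1 this)
  have hden : padicNorm p (q.den : ℚ) < 1 := (padicNorm.nat_lt_one_iff _).2 hpd
  have hpos : 0 < padicNorm p (q.den : ℚ) :=
    lt_of_le_of_ne (padicNorm.nonneg _) (Ne.symm (padicNorm.nonzero (by simp)))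
  rw [← Rat.num_div_den q, padicNorm.div, hnum]
  exact (one_lt_div hpos).2 hden

/-- The coefficient `2 / (d - 1)` of the Descartes-Soddy relation is not an integer for `d > 3`. -/
lemma exists_prime_one_lt_padicNorm_coeff {d : ℕ} (hd : 3 < d) :
    ∃ p : ℕ, p.Prime ∧ 1 < padicNorm p (2 / ((d : ℚ) - 1)) := by
  refine exists_prime_one_lt_padicNorm fun h => ?_
  have hq := Rat.coe_int_num_of_den_eq_one h
  have hd' : (3 : ℚ) < d := by exact_mod_cast hd
  have h0 : 0 < 2 / ((d : ℚ) - 1) := div_pos (by norm_num) (by linarith)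
  have h1 : 2 / ((d : ℚ) - 1) < 1 := (div_lt_one (by linarith)).2 (by linarith)
  rw [← hq] at h0 h1
  have h2 : 0 < (2 / ((d : ℚ) - 1)).num := by exact_mod_cast h0
  have h3 : (2 / ((d : ℚ) - 1)).num < 1 := by exact_mod_cast h1
  omega

section Ultrametric

variable {p : ℕ} [Fact p.Prime] {α : Type*} {c z M : ℚ} {f : α → ℚ} {T : Finset α}

lemma padicNorm_reflection_lt (hc : 1 < padicNorm p c) (hM : 1 < M)
    (hz : padicNorm p z < padicNorm p c * M) (hf : ∀ t ∈ T, padicNorm p (f t) < M) :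
    padicNorm p (-z + c * (∑ t ∈ T, f t - 1)) < padicNorm p c * M := by
  refine lt_of_le_of_lt padicNorm.nonarchimedean (max_lt (by rwa [padicNorm.neg]) ?_)
  rw [padicNorm.mul]
  refine mul_lt_mul_of_pos_left ?_ (by linarith)
  refine lt_of_le_of_lt padicNorm.sub (max_lt ?_ (by rwa [padicNorm.one]))
  exact padicNorm.sum_lt' hf (by linarith)

/-- If some term of the sum has the strictly largest norm, and this norm exceeds `1`, then the
reflected value has a norm that is larger by the factor `|c|`. -/
lemma padicNorm_reflection_eq (hc : 1 < padicNorm p c) {t₀ : α} (ht₀ : t₀ ∈ T)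
    (h1 : 1 < padicNorm p (f t₀)) (hz : padicNorm p z < padicNorm p (f t₀))
    (hf : ∀ t ∈ T, t ≠ t₀ → padicNorm p (f t) < padicNorm p (f t₀)) :
    padicNorm p (-z + c * (∑ t ∈ T, f t - 1)) = padicNorm p c * padicNorm p (f t₀) := by
  classical
  have hlt : padicNorm p (-z + c * (∑ t ∈ T.erase t₀, f t - 1)) < padicNorm p (c * f t₀) := by
    rw [padicNorm.mul]
    refine padicNorm_reflection_lt hc h1 (by nlinarith) fun t ht => ?_
    exact hf t (Finset.mem_of_mem_erase ht) (Finset.ne_of_mem_erase ht)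
  rw [← Finset.add_sum_erase _ _ ht₀,
    show -z + c * (f t₀ + ∑ t ∈ T.erase t₀, f t - 1) =
      c * f t₀ + (-z + c * (∑ t ∈ T.erase t₀, f t - 1)) by ring,
    padicNorm.add_eq_max_of_ne hlt.ne', max_eq_left hlt.le, padicNorm.mul]

end Ultrametric

/-! ### Rational separations and dominant entries -/

open Classical in
/-- The rational number equal to a given real number, and `0` if that number is irrational. -/
noncomputable def ratOf (r : ℝ) : ℚ := if h : ∃ q : ℚ, (q : ℝ) = r then h.choose else 0

lemma cast_ratOf {r : ℝ} (h : ∃ q : ℚ, (q : ℝ) = r) : (ratOf r : ℝ) = r := by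
  rw [ratOf, dif_pos h]; exact h.choose_spec

lemma ratOf_cast (q : ℚ) : ratOf (q : ℝ) = q := by
  exact_mod_cast cast_ratOf ⟨q, rfl⟩

/-- The `p`-adic norm of the separation of two balls (meaningful when the separation is
rational). -/
noncomputable def sepNorm {d : ℕ} (p : ℕ) (A B : Set (ExtSpace d)) : ℚ :=
  padicNorm p (ratOf (sep A B))

lemma sepNorm_comm {d : ℕ} (p : ℕ) (A B : Set (ExtSpace d)) :
    sepNorm p A B = sepNorm p B A := by
  rw [sepNorm, sepNorm, sep_comm]

lemma IsBall.sepNorm_self {d p : ℕ} [Fact p.Prime] {A : Set (ExtSpace d)} (hA : IsBall A) :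
    sepNorm p A A = 1 := by
  rw [sepNorm, hA.sep_self, ← Rat.cast_one, ratOf_cast, padicNorm.one]

lemma IsTangent.sepNorm_eq_zero {d p : ℕ} (hd : d ≠ 0) {A B : Set (ExtSpace d)}
    (h : IsTangent A B) (hA : IsBall A) (hB : IsBall B) : sepNorm p A B = 0 := by
  rw [sepNorm, h.sep_eq_zero hd hA hB, ← Rat.cast_zero, ratOf_cast, padicNorm.zero]

lemma IsCluster.sepNorm_le_one {d p : ℕ} [Fact p.Prime] (hd : d ≠ 0)
    {C : Finset (Set (ExtSpace d))} (hC : IsCluster C) {A B : Set (ExtSpace d)} (hA : A ∈ C)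
    (hB : B ∈ C) : sepNorm p A B ≤ 1 := by
  by_cases h : A = B
  · rw [h, (hC.isBall _ hB).sepNorm_self]
  · rw [(hC.pairwise hA hB h).sepNorm_eq_zero hd (hC.isBall _ hA) (hC.isBall _ hB)]
    exact zero_le_one

/-- The ball `A` of the cluster `C` can be exchanged within `S`: its mirror image with respect to
the other balls of `C` belongs to `S`. -/
def Exchangeable {d : ℕ} (S : Set (Set (ExtSpace d))) (C : Finset (Set (ExtSpace d)))
    (A : Set (ExtSpace d)) : Prop :=
  ∃ R ∈ S, R ∉ C ∧ ∀ D ∈ C, D ≠ A → IsTangent D R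

lemma Exchangeable.mono {d : ℕ} {S S' : Set (Set (ExtSpace d))} {C : Finset (Set (ExtSpace d))}
    {A : Set (ExtSpace d)} (h : Exchangeable S C A) (hS : S ⊆ S') : Exchangeable S' C A := by
  obtain ⟨R, hR, h⟩ := h
  exact ⟨R, hS hR, h⟩

/-- Among the separations of `A` from the members of `C` one has the strictly largest `p`-adic norm,
this norm exceeds `1`, and the ball where it is attained can be exchanged within `S`. In the tree
of clusters, that ball is the last one introduced on the way from `A` to `C`. -/
def HasRowPeak {d : ℕ} (p : ℕ) (S : Set (Set (ExtSpace d))) (A : Set (ExtSpace d))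
    (C : Finset (Set (ExtSpace d))) : Prop :=
  ∃ J ∈ C, 1 < sepNorm p A J ∧ (∀ K ∈ C, K ≠ J → sepNorm p A K < sepNorm p A J) ∧
    Exchangeable S C J

/-- Among the separations of the members of `C` from those of `C'` one has the strictly largest
`p`-adic norm, this norm exceeds `1`, and the two balls where it is attained can be exchanged
within `S`. In the tree of clusters, these are the first ball dropped and the last one introduced
on the way from `C` to `C'`. -/
def HasPeak {d : ℕ} (p : ℕ) (S : Set (Set (ExtSpace d))) (C C' : Finset (Set (ExtSpace d))) :
    Prop :=
  ∃ I ∈ C, ∃ J ∈ C', 1 < sepNorm p I J ∧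
    (∀ I' ∈ C, ∀ J' ∈ C', (I' ≠ I ∨ J' ≠ J) → sepNorm p I' J' < sepNorm p I J) ∧
    Exchangeable S C I ∧ Exchangeable S C' J

lemma HasRowPeak.mono {d p : ℕ} {S S' : Set (Set (ExtSpace d))} {A : Set (ExtSpace d)}
    {C : Finset (Set (ExtSpace d))} (h : HasRowPeak p S A C) (hS : S ⊆ S') :
    HasRowPeak p S' A C := by
  obtain ⟨J, hJ, h1, h2, h3⟩ := h
  exact ⟨J, hJ, h1, h2, h3.mono hS⟩

lemma HasPeak.mono {d p : ℕ} {S S' : Set (Set (ExtSpace d))} {C C' : Finset (Set (ExtSpace d))}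
    (h : HasPeak p S C C') (hS : S ⊆ S') : HasPeak p S' C C' := by
  obtain ⟨I, hI, J, hJ, h1, h2, h3, h4⟩ := h
  exact ⟨I, hI, J, hJ, h1, h2, h3.mono hS, h4.mono hS⟩

lemma HasPeak.symm {d p : ℕ} {S : Set (Set (ExtSpace d))} {C C' : Finset (Set (ExtSpace d))}
    (h : HasPeak p S C C') : HasPeak p S C' C := by
  obtain ⟨I, hI, J, hJ, h1, h2, h3, h4⟩ := h
  refine ⟨J, hJ, I, hI, by rwa [sepNorm_comm], fun J' hJ' I' hI' h => ?_, h4, h3⟩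
  rw [sepNorm_comm p J' I', sepNorm_comm p J I]
  exact h2 I' hI' J' hJ' h.symm

/-- A peak between two clusters dominates in particular the row of the exchanged ball. -/
lemma HasPeak.hasRowPeak {d p : ℕ} {S : Set (Set (ExtSpace d))} {A : Set (ExtSpace d)}
    {C C' : Finset (Set (ExtSpace d))} (h : HasPeak p S C C')
    (hA : ∀ I ∈ C, Exchangeable S C I → I = A) : HasRowPeak p S A C' := by
  obtain ⟨I, hI, J, hJ, h1, h2, h3, h4⟩ := h
  obtain rfl := hA I hI h3
  exact ⟨J, hJ, h1, fun K hK hKJ => h2 I hI K hK (.inr hKJ), h4⟩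

/-- The properties of a collection of balls that persist when balls are introduced: the separations
are rational, `d + 1` pairwise tangent balls always extend to a cluster, and the separations of a
ball from a cluster not containing it, and those between two distinct clusters, have a peak. -/
structure IsTreelike {d : ℕ} (p : ℕ) (S : Set (Set (ExtSpace d))) : Prop where
  isBall : ∀ A ∈ S, IsBall A
  rat : ∀ A ∈ S, ∀ B ∈ S, ∃ q : ℚ, (q : ℝ) = sep A B
  extend : ∀ T : Finset (Set (ExtSpace d)), (T : Set (Set (ExtSpace d))) ⊆ S → T.card = d + 1 →
    (T : Set (Set (ExtSpace d))).Pairwise IsTangent → ∃ Z ∈ S, Z ∉ T ∧ ∀ A ∈ T, IsTangent A Z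
  rowPeak : ∀ A ∈ S, ∀ C : Finset (Set (ExtSpace d)), IsCluster C →
    (C : Set (Set (ExtSpace d))) ⊆ S → A ∉ C → HasRowPeak p S A C
  peak : ∀ C C' : Finset (Set (ExtSpace d)), IsCluster C → (C : Set (Set (ExtSpace d))) ⊆ S →
    IsCluster C' → (C' : Set (Set (ExtSpace d))) ⊆ S → C ≠ C' → HasPeak p S C C'

/-! ### Introducing a ball -/

open Classical in
/-- The ball `B` is new to `S` and is tangent to all members of `T`, where `insert Z T` is a cluster
of `S`. -/
structure IsAttached {d : ℕ} (S : Set (Set (ExtSpace d))) (T : Finset (Set (ExtSpace d)))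
    (Z B : Set (ExtSpace d)) : Prop where
  subset : (T : Set (Set (ExtSpace d))) ⊆ S
  mem : Z ∈ S
  notMem : Z ∉ T
  cluster : IsCluster (insert Z T)
  isBall : IsBall B
  new : B ∉ S
  tangent : ∀ A ∈ T, IsTangent A B

open Classical in
lemma isCluster_insert {d : ℕ} {T : Finset (Set (ExtSpace d))} {Z : Set (ExtSpace d)}
    (hT : ∀ A ∈ T, IsBall A) (hcard : T.card = d + 1)
    (hp : (T : Set (Set (ExtSpace d))).Pairwise IsTangent) (hZ : IsBall Z) (hZT : Z ∉ T)
    (h : ∀ A ∈ T, IsTangent A Z) : IsCluster (insert Z T) where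
  isBall := by
    intro A hA
    rcases Finset.mem_insert.1 hA with rfl | hA
    exacts [hZ, hT A hA]
  card := by rw [Finset.card_insert_of_notMem hZT, hcard]
  pairwise := by
    rw [Finset.coe_insert]
    exact hp.insert fun A hA _ => ⟨(h A hA).symm, h A hA⟩

lemma IsTreelike.exists_isAttached {d p : ℕ} {S : Set (Set (ExtSpace d))} {B : Set (ExtSpace d)}
    (hS : IsTreelike p S) (hB : CanIntroduce S B) :
    ∃ (T : Finset (Set (ExtSpace d))) (Z : Set (ExtSpace d)), IsAttached S T Z B := by
  obtain ⟨hball, hnew, T, hTS, hcard, hp, ht⟩ := hB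
  have hfin : T.Finite := Set.finite_of_ncard_ne_zero (by omega)
  lift T to Finset (Set (ExtSpace d)) using hfin
  rw [Set.ncard_coe_finset] at hcard
  obtain ⟨Z, hZS, hZT, hZ⟩ := hS.extend T hTS hcard hp
  exact ⟨T, Z, hTS, hZS, hZT, isCluster_insert (fun A hA => hS.isBall A (hTS hA)) hcard hp
    (hS.isBall Z hZS) hZT hZ, hball, hnew, ht⟩

namespace IsAttached

variable {d p : ℕ} {S : Set (Set (ExtSpace d))} {T : Finset (Set (ExtSpace d))}
  {Z B : Set (ExtSpace d)}

lemma ne (h : IsAttached S T Z B) : B ≠ Z := fun hBZ => h.new (hBZ ▸ h.mem)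

lemma notMem_new (h : IsAttached S T Z B) : B ∉ T := fun hB => h.new (h.subset hB)

lemma isBall_of_mem (h : IsAttached S T Z B) {A : Set (ExtSpace d)} (hA : A ∈ T) : IsBall A :=
  h.cluster.isBall A (Finset.mem_insert_of_mem hA)

lemma card (h : IsAttached S T Z B) : T.card = d + 1 := by
  have := h.cluster.card
  rw [Finset.card_insert_of_notMem h.notMem] at this
  omega

lemma pairwise (h : IsAttached S T Z B) : (T : Set (Set (ExtSpace d))).Pairwise IsTangent :=
  h.cluster.pairwise.mono (by simp)

lemma tangent_mem (h : IsAttached S T Z B) {A : Set (ExtSpace d)} (hA : A ∈ T) :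
    IsTangent A Z :=
  h.cluster.pairwise (by simp [hA]) (by simp) fun hAZ => h.notMem (hAZ ▸ hA)

open Classical in
lemma cluster_subset (h : IsAttached S T Z B) :
    ((insert Z T : Finset (Set (ExtSpace d))) : Set (Set (ExtSpace d))) ⊆ S := by
  rw [Finset.coe_insert]
  exact Set.insert_subset h.mem h.subset

open Classical in
lemma cluster_new (h : IsAttached S T Z B) : IsCluster (insert B T) :=
  isCluster_insert (fun _ hA => h.isBall_of_mem hA) h.card h.pairwise h.isBall h.notMem_new
    h.tangent

open Classical in
lemma cluster_new_subset (h : IsAttached S T Z B) :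
    ((insert B T : Finset (Set (ExtSpace d))) : Set (Set (ExtSpace d))) ⊆ insert B S := by
  rw [Finset.coe_insert]
  exact Set.insert_subset_insert h.subset

open Classical in
lemma exchangeable_old (h : IsAttached S T Z B) : Exchangeable (insert B S) (insert Z T) Z := by
  refine ⟨B, Set.mem_insert _ _, ?_, fun D hD hDZ => h.tangent D ?_⟩
  · rw [Finset.mem_insert, not_or]; exact ⟨h.ne, h.notMem_new⟩
  · exact (Finset.mem_insert.1 hD).resolve_left hDZ

open Classical in
lemma exchangeable_new (h : IsAttached S T Z B) : Exchangeable (insert B S) (insert B T) B := by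
  refine ⟨Z, Set.mem_insert_of_mem _ h.mem, ?_, fun D hD hDZ => h.tangent_mem ?_⟩
  · rw [Finset.mem_insert, not_or]; exact ⟨h.ne.symm, h.notMem⟩
  · exact (Finset.mem_insert.1 hD).resolve_left hDZ

open Classical in
/-- The ball opposite to the attached one could not be exchanged before: its mirror image is the
attached ball. -/
lemma not_exchangeable (hd : 1 < d) (h : IsAttached S T Z B) (hS : IsTreelike p S) :
    ¬ Exchangeable S (insert Z T) Z := by
  rintro ⟨R, hR, hRC, hRT⟩
  rw [Finset.mem_insert, not_or] at hRC
  have : B = R := h.cluster.eq_of_tangent hd h.notMem h.isBall h.tangent h.ne (hS.isBall R hR)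
    (fun A hA => hRT A (Finset.mem_insert_of_mem hA) fun hAZ => h.notMem (hAZ ▸ hA)) hRC.1
  exact h.new (this ▸ hR)

lemma cast_sep (hd : 1 < d) (h : IsAttached S T Z B) (hS : IsTreelike p S)
    {X : Set (ExtSpace d)} (hX : X ∈ S) :
    ((-ratOf (sep X Z) + 2 / ((d : ℚ) - 1) * (∑ A ∈ T, ratOf (sep X A) - 1) : ℚ) : ℝ) =
      sep X B := by
  rw [h.cluster.sep_eq hd h.notMem h.isBall h.tangent h.ne X]
  push_cast
  rw [cast_ratOf (hS.rat X hX Z h.mem),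
    Finset.sum_congr rfl fun A hA => cast_ratOf (hS.rat X hX A (h.subset hA))]

lemma sepNorm_eq (hd : 1 < d) (h : IsAttached S T Z B) (hS : IsTreelike p S)
    {X : Set (ExtSpace d)} (hX : X ∈ S) :
    sepNorm p X B =
      padicNorm p (-ratOf (sep X Z) + 2 / ((d : ℚ) - 1) * (∑ A ∈ T, ratOf (sep X A) - 1)) := by
  rw [sepNorm, ← h.cast_sep hd hS hX, ratOf_cast]

variable [Fact p.Prime]

/-- The separation of the attached ball from the opposite one is `-1 - 2 / (d - 1)`. -/
lemma sepNorm_opposite (hd : 1 < d) (hc : 1 < padicNorm p (2 / ((d : ℚ) - 1)))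
    (h : IsAttached S T Z B) (hS : IsTreelike p S) :
    sepNorm p Z B = padicNorm p (2 / ((d : ℚ) - 1)) := by
  have hZ := hS.isBall Z h.mem
  have h0 : ∀ A ∈ T, ratOf (sep Z A) = 0 := fun A hA => by
    rw [(h.tangent_mem hA).symm.sep_eq_zero (by omega) hZ (h.isBall_of_mem hA), ← Rat.cast_zero,
      ratOf_cast]
  have h1 : ratOf (sep Z Z) = 1 := by rw [hZ.sep_self, ← Rat.cast_one, ratOf_cast]
  rw [h.sepNorm_eq hd hS h.mem, Finset.sum_eq_zero h0, h1,
    show -1 + 2 / ((d : ℚ) - 1) * (0 - 1) = -(1 + 2 / ((d : ℚ) - 1)) by ring, padicNorm.neg,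
    padicNorm.add_eq_max_of_ne (by rw [padicNorm.one]; exact hc.ne), padicNorm.one,
    max_eq_right hc.le]

/-- The separation of the attached ball `B` from a ball of `S` outside `T` is dominant in the
cluster `insert B T`. -/
lemma sepNorm_lt (hd : 1 < d) (hc : 1 < padicNorm p (2 / ((d : ℚ) - 1)))
    (h : IsAttached S T Z B) (hS : IsTreelike p S) {X : Set (ExtSpace d)} (hX : X ∈ S)
    (hXT : X ∉ T) : 1 < sepNorm p X B ∧ ∀ A ∈ T, sepNorm p X A < sepNorm p X B := by
  classical
  by_cases hXZ : X = Z
  · subst hXZ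
    rw [h.sepNorm_opposite hd hc hS]
    refine ⟨hc, fun A hA => ?_⟩
    rw [(h.tangent_mem hA).symm.sepNorm_eq_zero (by omega) (hS.isBall X hX) (h.isBall_of_mem hA)]
    linarith
  · obtain ⟨J, hJ, h1, h2, h3⟩ := hS.rowPeak X hX (insert Z T) (by convert h.cluster)
      (by convert h.cluster_subset) (by simp [hXZ, hXT])
    have hJZ : J ≠ Z := by
      rintro rfl
      exact h.not_exchangeable hd hS (by convert h3)
    have hJT : J ∈ T := (Finset.mem_insert.1 hJ).resolve_left hJZ
    have hB : sepNorm p X B = padicNorm p (2 / ((d : ℚ) - 1)) * sepNorm p X J := by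
      rw [h.sepNorm_eq hd hS hX]
      exact padicNorm_reflection_eq (f := fun A => ratOf (sep X A)) hc hJT h1
        (h2 Z (Finset.mem_insert_self _ _) hJZ.symm)
        fun A hA hAJ => h2 A (Finset.mem_insert_of_mem hA) hAJ
    have hlt : sepNorm p X J < sepNorm p X B := by rw [hB]; nlinarith
    refine ⟨h1.trans hlt, fun A hA => ?_⟩
    by_cases hAJ : A = J
    · rwa [hAJ]
    · exact (h2 A (Finset.mem_insert_of_mem hA) hAJ).trans hlt

/-- The attached ball touches no balls of `S` but the members of `T`. -/
lemma isTangent_iff (hd : 1 < d) (hc : 1 < padicNorm p (2 / ((d : ℚ) - 1)))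
    (h : IsAttached S T Z B) (hS : IsTreelike p S) {X : Set (ExtSpace d)} (hX : X ∈ S) :
    IsTangent X B ↔ X ∈ T := by
  refine ⟨fun hXB => ?_, h.tangent X⟩
  by_contra hXT
  have h1 := (h.sepNorm_lt hd hc hS hX hXT).1
  rw [hXB.sepNorm_eq_zero (by omega) (hS.isBall X hX) h.isBall] at h1
  linarith

open Classical in
lemma subset_insert (hd : 1 < d) (hc : 1 < padicNorm p (2 / ((d : ℚ) - 1)))
    (h : IsAttached S T Z B) (hS : IsTreelike p S) {K : Finset (Set (ExtSpace d))}
    (hK : (K : Set (Set (ExtSpace d))) ⊆ insert B S)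
    (hp : (K : Set (Set (ExtSpace d))).Pairwise IsTangent) (hBK : B ∈ K) : K ⊆ insert B T := by
  intro A hA
  rw [Finset.mem_insert]
  by_cases hAB : A = B
  · exact .inl hAB
  · exact .inr ((h.isTangent_iff hd hc hS ((hK hA).resolve_left hAB)).1 (hp hA hBK hAB))

open Classical in
lemma eq_cluster_new (hd : 1 < d) (hc : 1 < padicNorm p (2 / ((d : ℚ) - 1)))
    (h : IsAttached S T Z B) (hS : IsTreelike p S) {C : Finset (Set (ExtSpace d))}
    (hC : IsCluster C) (hCS : (C : Set (Set (ExtSpace d))) ⊆ insert B S) (hBC : B ∈ C) :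
    C = insert B T :=
  Finset.eq_of_subset_of_card_le (h.subset_insert hd hc hS hCS hC.pairwise hBC)
    (by rw [hC.card, h.cluster_new.card])

open Classical in
lemma hasPeak_old_new (hd : 1 < d) (hc : 1 < padicNorm p (2 / ((d : ℚ) - 1)))
    (h : IsAttached S T Z B) (hS : IsTreelike p S) :
    HasPeak p (insert B S) (insert Z T) (insert B T) := by
  refine ⟨Z, by simp, B, by simp, ?_, fun I hI J hJ hIJ => ?_, h.exchangeable_old,
    h.exchangeable_new⟩ <;> rw [h.sepNorm_opposite hd hc hS]
  · exact hc
  · refine lt_of_le_of_lt ?_ hc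
    rcases Finset.mem_insert.1 hI with rfl | hIT
    · have hJT : J ∈ T := (Finset.mem_insert.1 hJ).resolve_left (hIJ.resolve_left (by simp))
      exact h.cluster.sepNorm_le_one (by omega) hI (Finset.mem_insert_of_mem hJT)
    · exact h.cluster_new.sepNorm_le_one (by omega) (Finset.mem_insert_of_mem hIT) hJ

open Classical in
/-- A peak between a cluster `C` and `insert Z T` is not attained at `Z`, hence reflection moves it
to the attached ball `B`. -/
lemma hasPeak_new (hd : 1 < d) (hc : 1 < padicNorm p (2 / ((d : ℚ) - 1)))
    (h : IsAttached S T Z B) (hS : IsTreelike p S) {C : Finset (Set (ExtSpace d))}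
    (hC : IsCluster C) (hCS : (C : Set (Set (ExtSpace d))) ⊆ S) :
    HasPeak p (insert B S) C (insert B T) := by
  by_cases hCZ : C = insert Z T
  · rw [hCZ]; exact h.hasPeak_old_new hd hc hS
  obtain ⟨I, hI, J, hJ, h1, h2, h3, h4⟩ :=
    hS.peak C (insert Z T) hC hCS h.cluster h.cluster_subset hCZ
  have hJZ : J ≠ Z := by
    rintro rfl
    exact h.not_exchangeable hd hS h4
  have hJT : J ∈ T := (Finset.mem_insert.1 hJ).resolve_left hJZ
  have hB : sepNorm p I B = padicNorm p (2 / ((d : ℚ) - 1)) * sepNorm p I J := by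
    rw [h.sepNorm_eq hd hS (hCS hI)]
    exact padicNorm_reflection_eq (f := fun A => ratOf (sep I A)) hc hJT h1
      (h2 I hI Z (Finset.mem_insert_self _ _) (.inr hJZ.symm))
      fun A hA hAJ => h2 I hI A (Finset.mem_insert_of_mem hA) (.inr hAJ)
  have hlt : sepNorm p I J < sepNorm p I B := by rw [hB]; nlinarith
  refine ⟨I, hI, B, Finset.mem_insert_self _ _, h1.trans hlt, fun I' hI' J' hJ' hIJ => ?_,
    h3.mono (Set.subset_insert _ _), h.exchangeable_new⟩
  rcases Finset.mem_insert.1 hJ' with rfl | hJ'T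
  · have hI'I : I' ≠ I := hIJ.resolve_right (by simp)
    rw [hB, h.sepNorm_eq hd hS (hCS hI')]
    refine padicNorm_reflection_lt (f := fun A => ratOf (sep I' A)) hc h1 ?_
      fun A hA => h2 I' hI' A (Finset.mem_insert_of_mem hA) (.inl hI'I)
    exact (h2 I' hI' Z (Finset.mem_insert_self _ _) (.inl hI'I)).trans (hB ▸ hlt)
  · by_cases hIJ' : I' = I ∧ J' = J
    · rw [hIJ'.1, hIJ'.2]; exact hlt
    · exact (h2 I' hI' J' (Finset.mem_insert_of_mem hJ'T) (not_and_or.1 hIJ')).trans hlt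

/-- Introducing a ball preserves the tree-like structure. -/
lemma isTreelike_insert (hd : 1 < d) (hc : 1 < padicNorm p (2 / ((d : ℚ) - 1)))
    (h : IsAttached S T Z B) (hS : IsTreelike p S) : IsTreelike p (insert B S) := by
  classical
  have old : ∀ {C : Finset (Set (ExtSpace d))}, (C : Set (Set (ExtSpace d))) ⊆ insert B S →
      B ∉ C → (C : Set (Set (ExtSpace d))) ⊆ S := fun hC hB A hA =>
    (hC hA).resolve_left fun hAB => hB (hAB ▸ hA)
  have hsub : S ⊆ insert B S := Set.subset_insert _ _
  refine ⟨?_, ?_, ?_, ?_, ?_⟩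
  · rintro A (rfl | hA)
    exacts [h.isBall, hS.isBall A hA]
  · rintro X (rfl | hX) Y (rfl | hY)
    · exact ⟨1, by rw [h.isBall.sep_self, Rat.cast_one]⟩
    · rw [sep_comm]; exact ⟨_, h.cast_sep hd hS hY⟩
    · exact ⟨_, h.cast_sep hd hS hX⟩
    · exact hS.rat X hX Y hY
  · intro T' hT' hcard hp
    by_cases hB : B ∈ T'
    · have hss := h.subset_insert hd hc hS hT' hp hB
      obtain ⟨Z', hZ', hZT'⟩ := Finset.exists_mem_notMem_of_card_lt_card
        (show T'.card < (insert B T).card by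
          have := h.cluster_new.card
          rw [hcard]; convert Nat.lt_succ_self (d + 1))
      refine ⟨Z', h.cluster_new_subset (by exact_mod_cast (by convert hZ')), hZT', fun A hA => ?_⟩
      exact h.cluster_new.pairwise (by exact_mod_cast hss hA) (by exact_mod_cast (by convert hZ'))
        fun hAZ => hZT' (hAZ ▸ hA)
    · obtain ⟨Z', hZ', hr⟩ := hS.extend T' (old hT' hB) hcard hp
      exact ⟨Z', hsub hZ', hr⟩
  · intro A hA C hC hCS hAC
    by_cases hB : B ∈ C
    · obtain rfl := h.eq_cluster_new hd hc hS hC hCS hB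
      rw [Finset.mem_insert, not_or] at hAC
      obtain ⟨h1, h2⟩ := h.sepNorm_lt hd hc hS (hA.resolve_left hAC.1) hAC.2
      exact ⟨B, Finset.mem_insert_self _ _, h1, fun K hK hKB =>
        h2 K ((Finset.mem_insert.1 hK).resolve_left hKB), h.exchangeable_new⟩
    · rcases hA with rfl | hA
      · refine (h.hasPeak_new hd hc hS hC (old hCS hB)).symm.hasRowPeak ?_
        rintro I - ⟨R, hR, hRC, hRT⟩
        -- In the new cluster only the new ball can be exchanged: the mirror image `R` of any other
        -- member would be a ball of `S` outside `T` that touches the new ball.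
        by_contra hIA
        rw [Finset.mem_insert, not_or] at hRC
        exact hRC.2 ((h.isTangent_iff hd hc hS (hR.resolve_left hRC.1)).1
          (hRT A (Finset.mem_insert_self _ _) (Ne.symm hIA)).symm)
      · exact (hS.rowPeak A hA C hC (old hCS hB) hAC).mono hsub
  · intro C C' hC hCS hC' hCS' hne
    by_cases hB : B ∈ C
    · obtain rfl := h.eq_cluster_new hd hc hS hC hCS hB
      by_cases hB' : B ∈ C'
      · exact absurd (h.eq_cluster_new hd hc hS hC' hCS' hB').symm hne
      · exact (h.hasPeak_new hd hc hS hC' (old hCS' hB')).symm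
    · by_cases hB' : B ∈ C'
      · obtain rfl := h.eq_cluster_new hd hc hS hC' hCS' hB'
        exact h.hasPeak_new hd hc hS hC (old hCS hB)
      · exact (hS.peak C C' hC (old hCS hB) hC' (old hCS' hB') hne).mono hsub

end IsAttached

/-! ### Collections built from a Descartes configuration -/

lemma isTreelike_of_isDescartes {d p : ℕ} (hd : 1 < d) {S : Set (Set (ExtSpace d))}
    (hS : IsDescartes S) : IsTreelike p S := by
  obtain ⟨⟨hball, -⟩, hcard, hp⟩ := hS
  have hfin : S.Finite := Set.finite_of_ncard_ne_zero (by omega)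
  lift S to Finset (Set (ExtSpace d)) using hfin
  rw [Set.ncard_coe_finset] at hcard
  have heq : ∀ C : Finset (Set (ExtSpace d)), IsCluster C →
      (C : Set (Set (ExtSpace d))) ⊆ S → C = S := fun C hC hCS =>
    Finset.eq_of_subset_of_card_le (by exact_mod_cast hCS) (by rw [hC.card, hcard])
  refine ⟨hball, fun A hA B hB => ?_, fun T hT hTc _ => ?_, fun A hA C hC hCS hAC => ?_,
    fun C C' hC hCS hC' hCS' hne => ?_⟩
  · by_cases hAB : A = B
    · exact ⟨1, by rw [hAB, (hball B hB).sep_self, Rat.cast_one]⟩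
    · exact ⟨0, by rw [(hp hA hB hAB).sep_eq_zero (by omega) (hball A hA) (hball B hB),
        Rat.cast_zero]⟩
  · obtain ⟨Z, hZ, hZT⟩ := Finset.exists_mem_notMem_of_card_lt_card (show T.card < S.card by omega)
    exact ⟨Z, hZ, hZT, fun A hA => hp (hT hA) hZ fun h => hZT (h ▸ hA)⟩
  · exact absurd (by rw [heq C hC hCS]; exact hA) hAC
  · exact absurd ((heq C hC hCS).trans (heq C' hC' hCS').symm) hne

lemma BuiltFrom.isTreelike {d p : ℕ} [Fact p.Prime] (hd : 1 < d)
    (hc : 1 < padicNorm p (2 / ((d : ℚ) - 1))) {S₀ S : Set (Set (ExtSpace d))}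
    (hS₀ : IsDescartes S₀) (hS : BuiltFrom S₀ S) : IsTreelike p S := by
  induction hS with
  | refl => exact isTreelike_of_isDescartes hd hS₀
  | introduce _ hB ih =>
    obtain ⟨T, Z, h⟩ := ih.exists_isAttached hB
    exact h.isTreelike_insert hd hc ih

/-! ### The tangency graph -/

open Classical in
lemma isNClique_subtype {d : ℕ} {P : Set (Set (ExtSpace d))} {K : Finset (Set (ExtSpace d))}
    (hK : (K : Set (Set (ExtSpace d))) ⊆ P)
    (hp : (K : Set (Set (ExtSpace d))).Pairwise IsTangent) :
    (tangencyGraph P).IsNClique K.card (K.subtype (· ∈ P)) := by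
  rw [SimpleGraph.isNClique_iff]
  constructor
  · intro A hA B hB hAB
    refine ⟨hAB, hp (Finset.mem_subtype.1 hA) (Finset.mem_subtype.1 hB)
      fun h => hAB (Subtype.ext h)⟩
  · rw [Finset.card_subtype, Finset.filter_true_of_mem fun A hA => hK hA]

lemma BuiltFrom.isKTreeOn {d p : ℕ} [Fact p.Prime] (hd : 1 < d)
    (hc : 1 < padicNorm p (2 / ((d : ℚ) - 1))) {S₀ S P : Set (Set (ExtSpace d))}
    (hS₀ : IsDescartes S₀) (hS : BuiltFrom S₀ S) (hSP : S ⊆ P) :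
    IsKTreeOn (tangencyGraph P) (d + 1) {A : P | (A : Set (ExtSpace d)) ∈ S} := by
  classical
  induction hS with
  | refl =>
    obtain ⟨-, hcard, hp⟩ := hS₀
    have hfin : S₀.Finite := Set.finite_of_ncard_ne_zero (by omega)
    lift S₀ to Finset (Set (ExtSpace d)) using hfin
    rw [Set.ncard_coe_finset] at hcard
    have h := IsKTreeOn.base (k := d + 1) _ (hcard ▸ isNClique_subtype hSP hp)
    convert h using 1
    ext A
    simp
  | @introduce S B hS hB ih =>
    have ht := hS.isTreelike hd hc hS₀
    obtain ⟨T, Z, h⟩ := ht.exists_isAttached hB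
    have hSP' : S ⊆ P := (Set.subset_insert _ _).trans hSP
    have hBP : B ∈ P := hSP (Set.mem_insert _ _)
    have hadd := IsKTreeOn.add _ (⟨B, hBP⟩ : P) (T.subtype (· ∈ P)) (ih hSP') h.new
      (fun A hA => h.subset (Finset.mem_subtype.1 hA))
      (h.card ▸ isNClique_subtype (h.subset.trans hSP') h.pairwise) (fun A hA => by
        rw [Finset.mem_subtype, ← h.isTangent_iff hd hc ht hA]
        exact ⟨fun hBA => hBA.2.symm, fun hAB => ⟨fun hBA => h.new (by
          have : B = A := congrArg Subtype.val hBA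
          rw [this]; exact hA), hAB.symm⟩⟩)
    convert hadd using 1
    ext A
    simp [Subtype.ext_iff]

/-- Three clusters sharing `d + 1` balls are never distinct: these `d + 1` balls are touched by at
most two balls. -/
lemma not_exists_three_cliques {d : ℕ} (hd : 1 < d) {P : Set (Set (ExtSpace d))}
    (hP : ∀ A ∈ P, IsBall A) :
    ¬ ∃ t a b c : Finset P, t.card = d + 1 ∧ t ⊆ a ∧ t ⊆ b ∧ t ⊆ c ∧
      (tangencyGraph P).IsNClique (d + 2) a ∧ (tangencyGraph P).IsNClique (d + 2) b ∧
      (tangencyGraph P).IsNClique (d + 2) c ∧ a ≠ b ∧ a ≠ c ∧ b ≠ c := by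
  classical
  rintro ⟨t, a, b, c, ht, hta, htb, htc, ha, hb, hc, hab, hac, hbc⟩
  have key : ∀ a : Finset P, t ⊆ a → (tangencyGraph P).IsNClique (d + 2) a →
      ∃ z : P, z ∉ t ∧ a = insert z t ∧ ∀ A ∈ t, IsTangent (A : Set (ExtSpace d)) z := by
    intro a hta ha
    obtain ⟨z, hz, hzt⟩ := Finset.exists_mem_notMem_of_card_lt_card
      (show t.card < a.card by rw [ha.card_eq, ht]; omega)
    have hins : insert z t = a := Finset.eq_of_subset_of_card_le
      (Finset.insert_subset hz hta) (by rw [Finset.card_insert_of_notMem hzt, ha.card_eq, ht])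
    exact ⟨z, hzt, hins.symm, fun A hA =>
      (ha.isClique (hta hA) hz fun h => hzt (h ▸ hA)).2⟩
  obtain ⟨x, hxt, rfl, hx⟩ := key a hta ha
  obtain ⟨y, hyt, rfl, hy⟩ := key b htb hb
  obtain ⟨z, hzt, rfl, hz⟩ := key c htc hc
  have himg : ∀ {u : P}, u ∉ t →
      (u : Set (ExtSpace d)) ∉ t.map (Function.Embedding.subtype (· ∈ P)) := by
    intro u hu h
    obtain ⟨w, hw, hwu⟩ := Finset.mem_map.1 h
    exact hu (by rwa [← Subtype.ext hwu])
  have htan : ∀ {u : P}, (∀ A ∈ t, IsTangent (A : Set (ExtSpace d)) u) →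
      ∀ A ∈ t.map (Function.Embedding.subtype (· ∈ P)), IsTangent A (u : Set (ExtSpace d)) := by
    intro u hu A hA
    obtain ⟨w, hw, rfl⟩ := Finset.mem_map.1 hA
    exact hu w hw
  have hcl := isCluster_insert (T := t.map (Function.Embedding.subtype (· ∈ P)))
    (Z := (x : Set (ExtSpace d))) (fun A hA => by
      obtain ⟨w, hw, rfl⟩ := Finset.mem_map.1 hA
      exact hP _ w.2) (by rw [Finset.card_map, ht]) (by
      intro A hA B hB hAB
      obtain ⟨w, hw, rfl⟩ := Finset.mem_map.1 hA
      obtain ⟨w', hw', rfl⟩ := Finset.mem_map.1 hB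
      exact (ha.isClique (hta hw) (hta hw') fun h => hAB (congrArg _ h)).2)
    (hP x x.2) (himg hxt) (htan hx)
  have hyx : (y : Set (ExtSpace d)) ≠ x := fun h => hab (by rw [Subtype.ext h])
  have hzx : (z : Set (ExtSpace d)) ≠ x := fun h => hac (by rw [Subtype.ext h])
  have := hcl.eq_of_tangent hd (himg hxt) (hP y y.2) (htan hy) hyx (hP z z.2) (htan hz) hzx
  exact hbc (by rw [Subtype.ext this])

end BallPacking

theorem theorem4p9 (d : ℕ) (hd : 3 < d) (P : Set (Set (BallPacking.ExtSpace d)))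
    (hP : BallPacking.IsBallPacking P) (hA : BallPacking.IsApollonian P) :
    BallPacking.IsStackedPolytopal (BallPacking.tangencyGraph P) (d + 1) ∧
    ∀ (S₀ S : Set (Set (BallPacking.ExtSpace d))) (B : Set (BallPacking.ExtSpace d)),
      BallPacking.IsDescartes S₀ → BallPacking.BuiltFrom S₀ S → BallPacking.CanIntroduce S B →
      BallPacking.BuiltFrom (insert B S) P →
      {A | A ∈ S ∧ BallPacking.IsTangent A B}.ncard = d + 1 := by
  obtain ⟨p, hp, hc⟩ := BallPacking.exists_prime_one_lt_padicNorm_coeff hd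
  have : Fact p.Prime := ⟨hp⟩
  have hd1 : 1 < d := by omega
  refine ⟨⟨?_, BallPacking.not_exists_three_cliques hd1 hP.1⟩, ?_⟩
  · obtain ⟨S₀, hS₀, hb⟩ := hA
    have h := hb.isKTreeOn hd1 hc hS₀ subset_rfl
    rwa [show {A : P | (A : Set (BallPacking.ExtSpace d)) ∈ P} = univ from
      eq_univ_of_forall fun A => A.2] at h
  · intro S₀ S B hS₀ hS hB _
    have ht := hS.isTreelike hd1 hc hS₀
    obtain ⟨T, Z, h⟩ := ht.exists_isAttached hB
    have heq : {A | A ∈ S ∧ BallPacking.IsTangent A B} = (T : Set (Set (BallPacking.ExtSpace d))) :=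
      Set.ext fun A => ⟨fun hA => (h.isTangent_iff hd1 hc ht hA.1).1 hA.2,
        fun hA => ⟨h.subset hA, h.tangent A hA⟩⟩
    rw [heq, Set.ncard_coe_finset, h.card]
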